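/- Let $n$ be even, let $\mathbb F_{2^n}$ be the finite field with $2^n$ elements, and regard $\mathbb F_2\subset\mathbb F_4$ as subfields of $\mathbb F_{2^n}$. Write $\mathrm{Tr}(x)=\sum_{i=0}^{n-1}x^{2^i}$ for the trace from $\mathbb F_{2^n}$ to $\mathbb F_2$, and $\mathrm{Inv}(x)=x^{-1}$ for $x\neq 0$, $\mathrm{Inv}(0)=0$. For a map $F:\mathbb F_{2^n}\to\mathbb F_{2^n}$ and $c\in\mathbb F_{2^n}$, the $c$-differential uniformity of $F$ is $${}_c\Delta_F=\max\bigl\{\#\{x\in\mathbb F_{2^n}: F(x+a)-cF(x)=b\}\ :\ a,b\in\mathbb F_{2^n},\ \text{and } a\ne 0\text{ if }c=1\bigr\}.$$ Let $\gamma\in\mathbb F_4\setminus\mathbb F_2$, let $c\in\mathbb F_{2^n}\setminus\mathbb F_4$, and let $F=\mathrm{Inv}\circ(0,1,\gamma)$, where $(0,1,\gamma)$ is the permutation of $\mathbb F_{2^n}$ with $0\mapsto1\mapsto\gamma\mapsto0$ that fixes every other element. Then $$3\le {}_c\Delta_F\le 4.$$ Furthermore, ${}_c\Delta_F=3$ if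 $$\mathrm{Tr}(c\gamma)=\mathrm{Tr}(c\gamma^2)=\mathrm{Tr}(c^{-1}\gamma)=\mathrm{Tr}(c^{-1}\gamma^2)=\mathrm{Tr}\!\left(\tfrac{c}{(c+\gamma)^2}\right)=\mathrm{Tr}\!\left(\tfrac{c\gamma^2}{(c+\gamma)^2}\right)=\mathrm{Tr}\!\left(\tfrac{c\gamma}{(c+\gamma^2)^2}\right)=\mathrm{Tr}\!\left(\tfrac{c}{(c+\gamma^2)^2}\right)=1.$$ -/

import Mathlib

namespace CDiff

variable {K : Type*} [Field K] [Fintype K] [DecidableEq K]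

/-- The `c`-differential `x ↦ F (x + a) - c F x` of `F` in direction `a`. -/
def cDeriv (c : K) (F : K → K) (a x : K) : K :=
  F (x + a) - c * F x

/-- The number of `x ∈ K` at which the `c`-differential of `F` in direction `a` equals `b`. -/
def cCount (c : K) (F : K → K) (a b : K) : ℕ :=
  (Finset.univ.filter fun x : K => cDeriv c F a x = b).card

/-- The `c`-differential uniformity of `F`: the maximum of `cCount c F a b` over all `a b : K`,
where `a = 0` is left out if `c = 1`. -/
def cUniformity (c : K) (F : K → K) : ℕ :=
  (Finset.univ.filter fun p : K × K => c = 1 → p.1 ≠ 0).sup fun p => cCount c F p.1 p.2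

/-- `Inv ∘ (0, 1, γ)`: the cycle `0 ↦ 1 ↦ γ ↦ 0` followed by inversion (with `0⁻¹ = 0`). -/
def invCycle (γ x : K) : K :=
  (List.formPerm [0, 1, γ] x)⁻¹

end CDiff

namespace CDiff

section Field

variable {K : Type*} [Field K]

section Values

variable [DecidableEq K]

/-! Write `w` for γ, so w² + w + 1 = 0. The map agrees with inversion off {0, 1, w}, so for a ≠ 0
every x outside the special points 0, 1, w, a, a+1, a+w satisfies bx² + (ab+1+c)x + ca = 0. Its
constant term is nonzero, so this gives at most two solutions. It remains to bound the special ones: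
at most two in general, at most one under the trace conditions, since a coincidence of two special
values would write a trace-one element as y² + y. For the lower bound, b is chosen as the value at a
special point (0 or 1), and the quadratic must have two further nonspecial roots, i.e. an
Artin–Schreier equation z² + z = v must be solvable. If c⁻¹w has the form y² + y, then a = 1 works;
otherwise a comes from a one-parameter family for which v is visibly of this form, and degree
counting avoids the bad parameters. -/

theorem invCycle_zero {γ : K} (h0 : γ ≠ 0) : invCycle γ (0 : K) = 1 := by
  simp [invCycle, List.formPerm_cons_cons, Equiv.swap_apply_def, h0.symm]

theorem invCycle_one {γ : K} (h0 : γ ≠ 0) (h1 : γ ≠ 1) : invCycle γ (1 : K) = γ⁻¹ := by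
  simp [invCycle, List.formPerm_cons_cons, Equiv.swap_apply_def, h0, h1]

theorem invCycle_self (γ : K) : invCycle γ γ = 0 := by
  simp [invCycle, List.formPerm_cons_cons]

theorem invCycle_of_ne {γ x : K} (h0 : x ≠ 0) (h1 : x ≠ 1) (h2 : x ≠ γ) :
    invCycle γ x = x⁻¹ := by
  simp [invCycle, List.formPerm_cons_cons, Equiv.swap_apply_def, h0, h1, h2]

end Values

theorem card_filter_toFinset_le {α : Type*} [DecidableEq α] (l : List α) (p : α → Prop)
    [DecidablePred p] : (l.toFinset.filter p).card ≤ l.countP p := by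
  have h : l.toFinset.filter p = (l.filter p).toFinset := by ext; simp
  rw [h, List.countP_eq_length_filter]
  exact List.toFinset_card_le _

/-! ### Coincidences among the six special values -/

variable [CharP K 2] {w a b c : K}

theorem ne_values_diag (hw : w ^ 2 + w + 1 = 0) (hc1 : c ≠ 1) (ha0 : a ≠ 0) (ha1 : a ≠ 1)
    (haw : a ≠ w) (haw' : a ≠ w + 1) :
    a⁻¹ + c ≠ 1 + c * a⁻¹ ∧ (a + 1)⁻¹ + c * (w + 1) ≠ w + 1 + c * (a + 1)⁻¹ ∧
      (a + w)⁻¹ ≠ c * (a + w)⁻¹ := by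
  have : a + w ≠ 0 := by grind
  have : a + 1 ≠ 0 := by grind
  refine ⟨?_, ?_, ?_⟩ <;> grind

/-- With `values_triple₂`, this covers all eight ways to pick one point from each pair {s, s+a}, s =
0, 1, w. The substitution x ↦ x + a, c ↦ c⁻¹, b ↦ b/c exchanges the two lemmas. -/
theorem values_triple₁ (hw : w ^ 2 + w + 1 = 0) (hc0 : c ≠ 0) (hcw : c ≠ w) (ha0 : a ≠ 0)
    (ha1 : a ≠ 1) (haw : a ≠ w) (haw' : a ≠ w + 1) :
    ¬ (a⁻¹ + c = b ∧ (a + 1)⁻¹ + c * (w + 1) = b ∧ c * (a + w)⁻¹ = b) ∧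
    ¬ (a⁻¹ + c = b ∧ (a + w)⁻¹ = b ∧ w + 1 + c * (a + 1)⁻¹ = b) ∧
    ¬ ((a + 1)⁻¹ + c * (w + 1) = b ∧ (a + w)⁻¹ = b ∧ 1 + c * a⁻¹ = b) ∧
    ¬ (a⁻¹ + c = b ∧ (a + 1)⁻¹ + c * (w + 1) = b ∧ (a + w)⁻¹ = b) := by
  have : a + w ≠ 0 := by grind
  have : a + 1 ≠ 0 := by grind
  refine ⟨?_, ?_, ?_, ?_⟩
  · grind
  · grind
  · grind
  · grind

theorem values_triple₂ (hw : w ^ 2 + w + 1 = 0) (hc0 : c ≠ 0) (hcw : c ≠ w + 1) (ha0 : a ≠ 0)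
    (ha1 : a ≠ 1) (haw : a ≠ w) (haw' : a ≠ w + 1) :
    ¬ (1 + c * a⁻¹ = b ∧ w + 1 + c * (a + 1)⁻¹ = b ∧ (a + w)⁻¹ = b) ∧
    ¬ (1 + c * a⁻¹ = b ∧ c * (a + w)⁻¹ = b ∧ (a + 1)⁻¹ + c * (w + 1) = b) ∧
    ¬ (w + 1 + c * (a + 1)⁻¹ = b ∧ c * (a + w)⁻¹ = b ∧ a⁻¹ + c = b) ∧
    ¬ (1 + c * a⁻¹ = b ∧ w + 1 + c * (a + 1)⁻¹ = b ∧ c * (a + w)⁻¹ = b) := by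
  have : a + w ≠ 0 := by grind
  have : a + 1 ≠ 0 := by grind
  refine ⟨?_, ?_, ?_, ?_⟩
  · grind
  · grind
  · grind
  · grind

/-- Each equality is a quadratic in `a`; scaling `a`, and shifting it if needed, brings it to
Artin–Schreier form. The lemmas below use the same method. -/
theorem ne_values_same₁ (hw : w ^ 2 + w + 1 = 0) (hc0 : c ≠ 0) (ha0 : a ≠ 0)
    (ha1 : a ≠ 1) (haw : a ≠ w) (h : ∀ y : K, y ^ 2 + y ≠ c⁻¹ * w ^ 2) :
    a⁻¹ + c ≠ (a + 1)⁻¹ + c * (w + 1) ∧ a⁻¹ + c ≠ (a + w)⁻¹ ∧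
      (a + 1)⁻¹ + c * (w + 1) ≠ (a + w)⁻¹ := by
  have haw' : a + w ≠ 0 := by grind
  have ha1' : a + 1 ≠ 0 := by grind
  refine ⟨?_, ?_, ?_⟩ <;> intro e <;> field_simp at e
  · exact h a (by clear h; field_simp; grind)
  · exact h (a * (w + 1)) (by clear h; field_simp; grind)
  · exact h ((a + 1) * w) (by clear h; field_simp; grind)

theorem ne_values_same₂ (hw : w ^ 2 + w + 1 = 0) (ha0 : a ≠ 0) (ha1 : a ≠ 1) (haw : a ≠ w)
    (h : ∀ y : K, y ^ 2 + y ≠ c * w ^ 2) :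
    1 + c * a⁻¹ ≠ w + 1 + c * (a + 1)⁻¹ ∧ 1 + c * a⁻¹ ≠ c * (a + w)⁻¹ ∧
      w + 1 + c * (a + 1)⁻¹ ≠ c * (a + w)⁻¹ := by
  have haw' : a + w ≠ 0 := by grind
  have ha1' : a + 1 ≠ 0 := by grind
  refine ⟨?_, ?_, ?_⟩ <;> intro e <;> field_simp at e
  · exact h a (by grind)
  · exact h (a * (w + 1)) (by grind)
  · exact h ((a + 1) * w) (by grind)

theorem ne_values_mixed₁ (hw : w ^ 2 + w + 1 = 0) (hc0 : c ≠ 0) (ha0 : a ≠ 0) (ha1 : a ≠ 1)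
    (h : ∀ y : K, y ^ 2 + y ≠ c * w) (h' : ∀ y : K, y ^ 2 + y ≠ c⁻¹ * w) :
    a⁻¹ + c ≠ w + 1 + c * (a + 1)⁻¹ ∧ (a + 1)⁻¹ + c * (w + 1) ≠ 1 + c * a⁻¹ := by
  have ha1' : a + 1 ≠ 0 := by grind
  refine ⟨?_, ?_⟩ <;> intro e <;> field_simp at e
  -- The normalised equation has right side cw + 1; the shift by w absorbs 1 = w² + w.
  · exact h ((c + w + 1) * a * (w + 1) + w) (by grind)
  · exact h' ((c⁻¹ + w + 1) * a * (w + 1) + w) (by clear h h'; field_simp; grind)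

theorem ne_values_mixed₂ (hw : w ^ 2 + w + 1 = 0) (hc0 : c ≠ 0) (ha0 : a ≠ 0) (ha1 : a ≠ 1)
    (haw : a ≠ w) (hcw : c ≠ w) (h : ∀ y : K, y ^ 2 + y ≠ c / (c + w) ^ 2) :
    a⁻¹ + c ≠ c * (a + w)⁻¹ ∧ (a + 1)⁻¹ + c * (w + 1) ≠ c * (a + w)⁻¹ := by
  have haw' : a + w ≠ 0 := by grind
  have ha1' : a + 1 ≠ 0 := by grind
  have hcw' : c + w ≠ 0 := by grind
  refine ⟨?_, ?_⟩ <;> intro e <;> field_simp at e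
  · exact h (c * a * w / (c + w)) (by field_simp; clear * - hw e; grind)
  · exact h (c * (a + 1) / (c + w)) (by clear h; field_simp; grind)

theorem ne_values_mixed₃ (hw : w ^ 2 + w + 1 = 0) (ha0 : a ≠ 0) (ha1 : a ≠ 1)
    (haw : a ≠ w) (hcw : c ≠ w + 1) (h : ∀ y : K, y ^ 2 + y ≠ c * w / (c + w ^ 2) ^ 2) :
    (a + w)⁻¹ ≠ 1 + c * a⁻¹ ∧ (a + w)⁻¹ ≠ w + 1 + c * (a + 1)⁻¹ := by
  have haw' : a + w ≠ 0 := by grind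
  have ha1' : a + 1 ≠ 0 := by grind
  have hcw' : c + w ^ 2 ≠ 0 := by grind
  refine ⟨?_, ?_⟩ <;> intro e <;> field_simp at e
  · exact h (a / (c + w ^ 2)) (by clear h; field_simp; grind)
  · exact h (w ^ 2 * (a + 1) / (c + w ^ 2)) (by field_simp; clear * - hw e; grind)

theorem ne_of_pow_four_ne (hw : w ^ 2 + w + 1 = 0) (hc : c ^ 4 ≠ c) :
    c ≠ 0 ∧ c ≠ 1 ∧ c ≠ w ∧ c ≠ w + 1 := by
  refine ⟨?_, ?_, ?_, ?_⟩ <;> grind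

/-- Three distinct roots would make the quadratic vanish identically, but its constant term is ca ≠
0. -/
theorem eq_of_quadratic_inv {x y z : K} (hc : c ≠ 0) (ha : a ≠ 0)
    (hx : x ≠ 0) (hxa : x + a ≠ 0) (ex : (x + a)⁻¹ - c * x⁻¹ = b)
    (hy : y ≠ 0) (hya : y + a ≠ 0) (ey : (y + a)⁻¹ - c * y⁻¹ = b)
    (hz : z ≠ 0) (hza : z + a ≠ 0) (ez : (z + a)⁻¹ - c * z⁻¹ = b)
    (hxy : x ≠ y) (hxz : x ≠ z) : y = z := by
  have key : ∀ t : K, t ≠ 0 → t + a ≠ 0 → (t + a)⁻¹ - c * t⁻¹ = b →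
      b * t ^ 2 + (a * b + 1 + c) * t + c * a = 0 := by
    intro t ht hta e
    field_simp at e
    clear * - e
    grind
  have kx := key x hx hxa ex
  have ky := key y hy hya ey
  have kz := key z hz hza ez
  clear * - kx ky kz hxy hxz hc ha
  by_contra hyz
  have h1 : b * (x + y) + (a * b + 1 + c) = 0 := by
    have : (x - y) * (b * (x + y) + (a * b + 1 + c)) = 0 := by linear_combination kx - ky
    exact (mul_eq_zero.1 this).resolve_left (sub_ne_zero.2 hxy)
  have h2 : b * (x + z) + (a * b + 1 + c) = 0 := by
    have : (x - z) * (b * (x + z) + (a * b + 1 + c)) = 0 := by linear_combination kx - kz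
    exact (mul_eq_zero.1 this).resolve_left (sub_ne_zero.2 hxz)
  have hb : b = 0 := by
    have : (y - z) * b = 0 := by linear_combination h1 - h2
    exact (mul_eq_zero.1 this).resolve_left (sub_ne_zero.2 hyz)
  have h3 : c * a = 0 := by linear_combination kx - x * h1 + x * y * hb
  exact mul_ne_zero hc ha h3

end Field

/-! ### Upper bounds -/

section Upper

variable {K : Type*} [Field K] [DecidableEq K] {w a b c : K}

theorem cDeriv_invCycle_special [CharP K 2] (hw : w ^ 2 + w + 1 = 0) (ha0 : a ≠ 0) (ha1 : a ≠ 1)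
    (haw : a ≠ w) (haw' : a ≠ w + 1) :
    cDeriv c (invCycle w) a 0 = a⁻¹ + c ∧ cDeriv c (invCycle w) a 1 = (a + 1)⁻¹ + c * (w + 1) ∧
    cDeriv c (invCycle w) a w = (a + w)⁻¹ ∧ cDeriv c (invCycle w) a a = 1 + c * a⁻¹ ∧
    cDeriv c (invCycle w) a (a + 1) = w + 1 + c * (a + 1)⁻¹ ∧
    cDeriv c (invCycle w) a (a + w) = c * (a + w)⁻¹ := by
  have h0 : w ≠ 0 := by grind
  have h1 : w ≠ 1 := by grind
  have hi : w⁻¹ = w + 1 := by grind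
  have e1 : invCycle w (a + 1) = (a + 1)⁻¹ := by apply invCycle_of_ne <;> grind
  have e2 : invCycle w (a + w) = (a + w)⁻¹ := by apply invCycle_of_ne <;> grind
  have e3 : a + 1 + a = 1 := by grind
  have e4 : a + w + a = w := by grind
  simp only [cDeriv, CharTwo.sub_eq_add, zero_add, add_comm 1 a, add_comm w a, e1, e2, e3, e4,
    CharTwo.add_self_eq_zero, invCycle_zero h0, invCycle_one h0 h1, invCycle_self,
    invCycle_of_ne ha0 ha1 haw, hi]
  simp

section Count

variable [Fintype K]

theorem cCount_zero_le_one (hc : c ≠ 1) : cCount c (invCycle w) 0 b ≤ 1 := by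
  rw [cCount, Finset.card_le_one]
  intro x hx y hy
  simp only [Finset.mem_filter, Finset.mem_univ, true_and, cDeriv, add_zero] at hx hy
  have h : (1 - c) * (invCycle w x - invCycle w y) = 0 := by linear_combination hx - hy
  have h' := (mul_eq_zero.1 h).resolve_left (sub_ne_zero.2 hc.symm)
  exact (List.formPerm [0, 1, w]).injective (inv_injective (sub_eq_zero.1 h'))

end Count

variable [CharP K 2]

theorem countP_special_le_two (hw : w ^ 2 + w + 1 = 0) (hc : c ^ 4 ≠ c) (ha0 : a ≠ 0)
    (ha1 : a ≠ 1) (haw : a ≠ w) (haw' : a ≠ w + 1) :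
    [0, 1, w, a, a + 1, a + w].countP (fun x => cDeriv c (invCycle w) a x = b) ≤ 2 := by
  obtain ⟨hc0, hc1, hcw, hcw'⟩ := ne_of_pow_four_ne hw hc
  obtain ⟨d0, d1, d2⟩ := ne_values_diag hw hc1 ha0 ha1 haw haw'
  obtain ⟨t1, t2, t3, t4⟩ := values_triple₁ (b := b) hw hc0 hcw ha0 ha1 haw haw'
  obtain ⟨u1, u2, u3, u4⟩ := values_triple₂ (b := b) hw hc0 hcw' ha0 ha1 haw haw'
  obtain ⟨e0, e1, e2, e3, e4, e5⟩ := cDeriv_invCycle_special (c := c) hw ha0 ha1 haw haw'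
  simp only [List.countP_cons, List.countP_nil, e0, e1, e2, e3, e4, e5, decide_eq_true_eq]
  clear e0 e1 e2 e3 e4 e5
  generalize a⁻¹ + c = A0 at *
  generalize (a + 1)⁻¹ + c * (w + 1) = A1 at *
  generalize w + 1 + c * (a + 1)⁻¹ = B1 at *
  generalize 1 + c * a⁻¹ = B0 at *
  generalize c * (a + w)⁻¹ = B2 at *
  generalize (a + w)⁻¹ = A2 at *
  clear * - d0 d1 d2 t1 t2 t3 t4 u1 u2 u3 u4
  by_cases h0 : A0 = b <;> by_cases h1 : A1 = b <;> by_cases h2 : A2 = b <;>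
    by_cases h3 : B0 = b <;> by_cases h4 : B1 = b <;> by_cases h5 : B2 = b <;> simp_all

theorem countP_special_le_one (hw : w ^ 2 + w + 1 = 0) (hc : c ^ 4 ≠ c) (ha0 : a ≠ 0)
    (ha1 : a ≠ 1) (haw : a ≠ w) (haw' : a ≠ w + 1)
    (h1 : ∀ y : K, y ^ 2 + y ≠ c * w) (h2 : ∀ y : K, y ^ 2 + y ≠ c * w ^ 2)
    (h3 : ∀ y : K, y ^ 2 + y ≠ c⁻¹ * w) (h4 : ∀ y : K, y ^ 2 + y ≠ c⁻¹ * w ^ 2)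
    (h5 : ∀ y : K, y ^ 2 + y ≠ c / (c + w) ^ 2)
    (h6 : ∀ y : K, y ^ 2 + y ≠ c * w / (c + w ^ 2) ^ 2) :
    [0, 1, w, a, a + 1, a + w].countP (fun x => cDeriv c (invCycle w) a x = b) ≤ 1 := by
  obtain ⟨hc0, hc1, hcw, hcw'⟩ := ne_of_pow_four_ne hw hc
  obtain ⟨d0, d1, d2⟩ := ne_values_diag hw hc1 ha0 ha1 haw haw'
  obtain ⟨s1, s2, s3⟩ := ne_values_same₁ hw hc0 ha0 ha1 haw h4
  obtain ⟨s4, s5, s6⟩ := ne_values_same₂ hw ha0 ha1 haw h2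
  obtain ⟨m1, m2⟩ := ne_values_mixed₁ hw hc0 ha0 ha1 h1 h3
  obtain ⟨m3, m4⟩ := ne_values_mixed₂ hw hc0 ha0 ha1 haw hcw h5
  obtain ⟨m5, m6⟩ := ne_values_mixed₃ hw ha0 ha1 haw hcw' h6
  obtain ⟨e0, e1, e2, e3, e4, e5⟩ := cDeriv_invCycle_special (c := c) hw ha0 ha1 haw haw'
  simp only [List.countP_cons, List.countP_nil, e0, e1, e2, e3, e4, e5, decide_eq_true_eq]
  clear e0 e1 e2 e3 e4 e5
  generalize a⁻¹ + c = A0 at *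
  generalize (a + 1)⁻¹ + c * (w + 1) = A1 at *
  generalize w + 1 + c * (a + 1)⁻¹ = B1 at *
  generalize 1 + c * a⁻¹ = B0 at *
  generalize c * (a + w)⁻¹ = B2 at *
  generalize (a + w)⁻¹ = A2 at *
  clear * - d0 d1 d2 s1 s2 s3 s4 s5 s6 m1 m2 m3 m4 m5 m6
  by_cases h0 : A0 = b <;> by_cases h1 : A1 = b <;> by_cases h2 : A2 = b <;>
    by_cases h3 : B0 = b <;> by_cases h4 : B1 = b <;> by_cases h5 : B2 = b <;> simp_all

/-- For `a` in the subfield with four elements, `x ↦ F (x + a) - c F x` is injective on that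
subfield. -/
theorem card_filter_subfield_le_one (hw : w ^ 2 + w + 1 = 0) (hc : c ^ 4 ≠ c)
    (ha : a = 1 ∨ a = w ∨ a = w + 1) :
    ([0, 1, w, w + 1].toFinset.filter (fun x => cDeriv c (invCycle w) a x = b)).card ≤ 1 := by
  obtain ⟨hc0, hc1, hcw, hcw'⟩ := ne_of_pow_four_ne hw hc
  have h0 : w ≠ 0 := by grind
  have h1 : w ≠ 1 := by grind
  have hi : w⁻¹ = w + 1 := by grind
  have hi' : invCycle w (w + 1) = w := by
    rw [invCycle_of_ne] <;> grind
  have hi'' : invCycle w (1 + w) = w := by rw [add_comm, hi']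
  -- The map permutes {0, 1, w, w+1}, so two points with the same value would express c as a
  -- quotient of elements of that subfield.
  rw [Finset.card_le_one]
  have e1 : w + 1 + 1 = w := by grind
  have e2 : w + 1 + w = 1 := by grind
  have e3 : w + (w + 1) = 1 := by grind
  have e4 : 1 + (w + 1) = w := by grind
  have h1w : w + 1 ≠ 0 := by grind
  have v0 := invCycle_zero h0
  have v1 := (invCycle_one h0 h1).trans hi
  have vw := invCycle_self w
  intro x hx y hy
  simp only [Finset.mem_filter, List.mem_toFinset, List.mem_cons, List.not_mem_nil,
    or_false] at hx hy
  obtain ⟨hx, ex⟩ := hx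
  obtain ⟨hy, ey⟩ := hy
  rw [← ey] at ex
  simp only [cDeriv] at ex
  clear ey
  rcases ha with rfl | rfl | rfl <;> rcases hx with rfl | rfl | rfl | rfl <;>
    rcases hy with rfl | rfl | rfl | rfl <;>
    first
    | rfl
    | (exfalso
       simp only [CharTwo.sub_eq_add, zero_add, e1, e2, e3, e4, v0, v1, vw, hi', hi'',
         CharTwo.add_self_eq_zero] at ex
       clear v0 v1 vw hi' hi'' hi hc
       grind)

variable [Fintype K]

theorem cCount_invCycle_le (hc : c ≠ 0) (ha : a ≠ 0) :
    cCount c (invCycle w) a b ≤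
      ([0, 1, w, a, a + 1, a + w].toFinset.filter
        (fun x => cDeriv c (invCycle w) a x = b)).card + 2 := by
  set p : K → Prop := fun x => cDeriv c (invCycle w) a x = b
  set L : List K := [0, 1, w, a, a + 1, a + w] with hL
  have hcard : ((Finset.univ.filter p) \ L.toFinset).card ≤ 2 := by
    by_contra! h
    obtain ⟨x, hx, y, hy, z, hz, hxy, hxz, hyz⟩ := Finset.two_lt_card.1 h
    have key : ∀ t ∈ (Finset.univ.filter p) \ L.toFinset,
        t ≠ 0 ∧ t + a ≠ 0 ∧ (t + a)⁻¹ - c * t⁻¹ = b := by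
      intro t ht
      simp only [hL, Finset.mem_sdiff, Finset.mem_filter, Finset.mem_univ, true_and,
        List.mem_toFinset, List.mem_cons, List.not_mem_nil, or_false, not_or] at ht
      obtain ⟨e, h0, h1, h2, h3, h4, h5⟩ := ht
      have ha0 : t + a ≠ 0 := by clear e; grind
      have ha1 : t + a ≠ 1 := by clear e; grind
      have haw : t + a ≠ w := by clear e; grind
      simp only [p, cDeriv, invCycle_of_ne ha0 ha1 haw, invCycle_of_ne h0 h1 h2] at e
      exact ⟨h0, ha0, e⟩
    obtain ⟨hx0, hxa, ex⟩ := key x hx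
    obtain ⟨hy0, hya, ey⟩ := key y hy
    obtain ⟨hz0, hza, ez⟩ := key z hz
    exact hyz (eq_of_quadratic_inv hc ha hx0 hxa ex hy0 hya ey hz0 hza ez hxy hxz)
  have hsub : Finset.univ.filter p ⊆
      L.toFinset.filter p ∪ ((Finset.univ.filter p) \ L.toFinset) := by
    intro x hx
    by_cases hxL : x ∈ L.toFinset <;> simp_all
  calc cCount c (invCycle w) a b ≤ _ := Finset.card_le_card hsub
    _ ≤ _ := Finset.card_union_le _ _
    _ ≤ _ := Nat.add_le_add_left hcard _

theorem cCount_invCycle_le_of_special (hw : w ^ 2 + w + 1 = 0) (hc : c ^ 4 ≠ c) {m : ℕ}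
    (hm : 1 ≤ m)
    (h : a ≠ 0 → a ≠ 1 → a ≠ w → a ≠ w + 1 →
      [0, 1, w, a, a + 1, a + w].countP (fun x => cDeriv c (invCycle w) a x = b) ≤ m) :
    cCount c (invCycle w) a b ≤ m + 2 := by
  obtain ⟨hc0, hc1, -⟩ := ne_of_pow_four_ne hw hc
  rcases eq_or_ne a 0 with rfl | ha0
  · exact (cCount_zero_le_one hc1).trans (by omega)
  refine (cCount_invCycle_le hc0 ha0).trans (Nat.add_le_add_right ?_ 2)
  by_cases ha : a = 1 ∨ a = w ∨ a = w + 1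
  -- Here the six special points collapse to the four-element subfield.
  · refine le_trans (le_of_eq ?_) ((card_filter_subfield_le_one (b := b) hw hc ha).trans hm)
    congr 2
    ext x
    simp only [List.mem_toFinset, List.mem_cons, List.not_mem_nil, or_false]
    rcases ha with rfl | rfl | rfl <;> clear h hc <;> grind
  · simp only [not_or] at ha
    exact (card_filter_toFinset_le _ _).trans (h ha0 ha.1 ha.2.1 ha.2.2)

theorem cUniformity_invCycle_le_four (hw : w ^ 2 + w + 1 = 0) (hc : c ^ 4 ≠ c) :
    cUniformity c (invCycle w) ≤ 4 :=
  Finset.sup_le fun _ _ => cCount_invCycle_le_of_special hw hc one_le_two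
    fun h0 h1 h2 h3 => countP_special_le_two hw hc h0 h1 h2 h3

theorem cUniformity_invCycle_le_three (hw : w ^ 2 + w + 1 = 0) (hc : c ^ 4 ≠ c)
    (h1 : ∀ y : K, y ^ 2 + y ≠ c * w) (h2 : ∀ y : K, y ^ 2 + y ≠ c * w ^ 2)
    (h3 : ∀ y : K, y ^ 2 + y ≠ c⁻¹ * w) (h4 : ∀ y : K, y ^ 2 + y ≠ c⁻¹ * w ^ 2)
    (h5 : ∀ y : K, y ^ 2 + y ≠ c / (c + w) ^ 2)
    (h6 : ∀ y : K, y ^ 2 + y ≠ c * w / (c + w ^ 2) ^ 2) :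
    cUniformity c (invCycle w) ≤ 3 :=
  Finset.sup_le fun _ _ => cCount_invCycle_le_of_special hw hc le_rfl
    fun g0 g1 g2 g3 => countP_special_le_one hw hc g0 g1 g2 g3 h1 h2 h3 h4 h5 h6

end Upper

/-! ### Lower bound -/

section Lower

open Polynomial

variable {K : Type*} [Field K] [Fintype K] [DecidableEq K] {w a b c : K}

theorem three_le_cUniformity {F : K → K} {x y z : K} (hc : c ≠ 1) (hx : cDeriv c F a x = b)
    (hy : cDeriv c F a y = b) (hz : cDeriv c F a z = b) (hxy : x ≠ y) (hxz : x ≠ z)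
    (hyz : y ≠ z) : 3 ≤ cUniformity c F := by
  have h1 : 3 ≤ cCount c F a b :=
    Finset.two_lt_card.2 ⟨x, by simpa using hx, y, by simpa using hy, z, by simpa using hz,
      hxy, hxz, hyz⟩
  refine h1.trans ?_
  exact Finset.le_sup (f := fun p : K × K => cCount c F p.1 p.2) (b := (a, b)) (by simp [hc])

variable [CharP K 2]

theorem three_le_cUniformity_of_exists (hw : w ^ 2 + w + 1 = 0) (hc : c ^ 4 ≠ c)
    (h : ∃ y : K, y ^ 2 + y = c⁻¹ * w) : 3 ≤ cUniformity c (invCycle w) := by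
  obtain ⟨hc0, hc1, hcw, hcw'⟩ := ne_of_pow_four_ne hw hc
  obtain ⟨y, hy⟩ := h
  have h0 : w ≠ 0 := by grind
  have h1 : w ≠ 1 := by grind
  have hi : w⁻¹ = w + 1 := by grind
  have hb : 1 + c * (w + 1) ≠ 0 := by clear hc; grind
  have key : ∀ z : K, z ^ 2 + z = c⁻¹ * w + 1 → ∃ x, x = c * w * z / (1 + c * (w + 1)) ∧
      x ≠ 1 ∧ cDeriv c (invCycle w) 1 x = 1 + c * (w + 1) := by
    intro z hz
    obtain ⟨x, hx⟩ : ∃ x, x = c * w * z / (1 + c * (w + 1)) := ⟨_, rfl⟩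
    refine ⟨x, hx, ?_⟩
    have hq : (1 + c * (w + 1)) * x ^ 2 + c * w * x + c = 0 := by
      rw [hx]
      field_simp at hz ⊢
      clear * - hz hw
      grind
    clear hx hz hy
    have x0 : x ≠ 0 := by clear hc; grind
    have x1 : x ≠ 1 := by clear hc; grind
    have xw : x ≠ w := by clear hc; grind
    have xw' : x ≠ w + 1 := by clear hc; grind
    have y0 : x + 1 ≠ 0 := by clear * - x1; grind
    have y1 : x + 1 ≠ 1 := by clear * - x0; grind
    have yw : x + 1 ≠ w := by clear * - xw'; grind
    refine ⟨x1, ?_⟩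
    rw [cDeriv, invCycle_of_ne x0 x1 xw, invCycle_of_ne y0 y1 yw]
    field_simp
    clear * - hq hw
    grind
  -- Again w² + w = 1 supplies the constant; the other root differs by 1.
  obtain ⟨x, hx, x1, ex⟩ := key (y + w) (by clear * - hw hy; grind)
  obtain ⟨x', hx', x1', ex'⟩ := key (y + w + 1) (by clear * - hw hy; grind)
  refine three_le_cUniformity hc1 ?_ ex ex' x1.symm x1'.symm ?_
  · rw [cDeriv, CharTwo.add_self_eq_zero, invCycle_zero h0, invCycle_one h0 h1, hi,
      CharTwo.sub_eq_add]
  · rw [hx, hx']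
    intro e
    field_simp at e
    simp at e

/-- With d² = c and a = t⁻¹ + 1, the conditions on t say in turn: a is defined; a ≠ 0, w; 1 + ac ≠
0; a + 1 is not a root; a + w is not a root. As polynomials in y their product has degree 2·7 = 14 <
16. -/
theorem exists_good_parameter {d : K} (hw : w ^ 2 + w + 1 = 0) (hc : c ^ 4 ≠ c) (hd : d ≠ 0)
    (hK : 16 ≤ Fintype.card K) :
    ∃ y t : K, t = d * (y ^ 2 + y) ∧ t ≠ 0 ∧ t ^ 2 + (w + 1) * t + w ≠ 0 ∧ (c + 1) * t + c ≠ 0 ∧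
      d * t + (d + 1) ≠ 0 ∧ (w + c * w ^ 2) * t ^ 2 + c * t + (c * w + 1) ≠ 0 := by
  obtain ⟨hc0, hc1, hcw, hcw'⟩ := ne_of_pow_four_ne hw hc
  have hlead : w + c * w ^ 2 ≠ 0 := by clear hc; grind
  have hlead' : c + 1 ≠ 0 := by clear hc; grind
  let Q₁ : K[X] := C 1 * X ^ 2 + C (w + 1) * X + C w
  let Q₂ : K[X] := C (c + 1) * X + C c
  let Q₃ : K[X] := C d * X + C (d + 1)
  let Q₄ : K[X] := C (w + c * w ^ 2) * X ^ 2 + C c * X + C (c * w + 1)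
  let R : K[X] := C d * X ^ 2 + C d * X + C 0
  have d1 : Q₁.natDegree = 2 := natDegree_quadratic one_ne_zero
  have d2 : Q₂.natDegree = 1 := natDegree_linear hlead'
  have d3 : Q₃.natDegree = 1 := natDegree_linear hd
  have d4 : Q₄.natDegree = 2 := natDegree_quadratic hlead
  have dR : R.natDegree = 2 := natDegree_quadratic hd
  have n1 : Q₁ ≠ 0 := ne_zero_of_natDegree_gt (n := 0) (by omega)
  have n2 : Q₂ ≠ 0 := ne_zero_of_natDegree_gt (n := 0) (by omega)
  have n3 : Q₃ ≠ 0 := ne_zero_of_natDegree_gt (n := 0) (by omega)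
  have n4 : Q₄ ≠ 0 := ne_zero_of_natDegree_gt (n := 0) (by omega)
  have dP : ((X * (Q₁ * (Q₂ * (Q₃ * Q₄)))).comp R).natDegree = 14 := by
    rw [natDegree_comp, natDegree_mul X_ne_zero (by simp [*]), natDegree_mul n1 (by simp [*]),
      natDegree_mul n2 (by simp [*]), natDegree_mul n3 n4, natDegree_X, d1, d2, d3, d4, dR]
  have nP : (X * (Q₁ * (Q₂ * (Q₃ * Q₄)))).comp R ≠ 0 :=
    ne_zero_of_natDegree_gt (n := 0) (by omega)
  obtain ⟨y, hy⟩ : ∃ y, ((X * (Q₁ * (Q₂ * (Q₃ * Q₄)))).comp R).eval y ≠ 0 := by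
    by_contra! h
    refine nP (Polynomial.eq_zero_of_natDegree_lt_card_of_eval_eq_zero _
      Function.injective_id h ?_)
    omega
  have hR : d * y ^ 2 + d * y + 0 = d * (y ^ 2 + y) := by ring
  simp only [Q₁, Q₂, Q₃, Q₄, R, eval_comp, eval_mul, eval_add, eval_pow, eval_X, eval_C, hR,
    mul_ne_zero_iff, one_mul] at hy
  exact ⟨y, _, rfl, mul_ne_zero hy.1.1 hy.1.2, hy.2⟩

theorem three_le_cUniformity_of_forall (hw : w ^ 2 + w + 1 = 0) (hc : c ^ 4 ≠ c)
    (hK : 16 ≤ Fintype.card K)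
    (h : ∀ y : K, y ^ 2 + y ≠ c⁻¹ * w) : 3 ≤ cUniformity c (invCycle w) := by
  obtain ⟨hc0, hc1, hcw, hcw'⟩ := ne_of_pow_four_ne hw hc
  obtain ⟨d, hd⟩ : ∃ d, d ^ 2 = c := by
    obtain ⟨d, hd⟩ := FiniteField.isSquare_of_char_two (ringChar.eq K 2 ▸ rfl) c
    exact ⟨d, by rw [hd, sq]⟩
  have hd0 : d ≠ 0 := by rintro rfl; exact hc0 (by simp [← hd])
  obtain ⟨y, t, ht, ht0, t1, t4, t2, t3⟩ := exists_good_parameter hw hc hd0 hK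
  -- This value, equivalent to a = w + 1, is excluded by `h` rather than by degree.
  have htw : t ≠ w + 1 := by
    intro e
    refine h (y ^ 2) ?_
    have e1 : t ^ 2 = c * (y ^ 2 + y) ^ 2 := by rw [ht, ← hd]; ring
    field_simp
    clear * - e e1 hw
    grind
  obtain ⟨a, ha⟩ : ∃ a, a = t⁻¹ + 1 := ⟨_, rfl⟩
  have hta : t * (a + 1) = 1 := by
    rw [ha]; clear * - ht0; grind
  have ha0 : a ≠ 0 := by rintro rfl; clear * - t1 hta; grind
  have ha1 : a ≠ 1 := by rintro rfl; clear * - hta; grind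
  have haw : a ≠ w := by rintro rfl; clear * - t1 htw hta hw; grind
  have haw' : a ≠ w + 1 := by rintro rfl; clear * - t1 htw hta hw; grind
  have ha1' : a + 1 ≠ 0 := by clear * - ha1; grind
  have hb : 1 + a * c ≠ 0 := by clear * - t4 hta; grind
  have h0 : w ≠ 0 := by grind
  obtain ⟨e0, -⟩ := cDeriv_invCycle_special (c := c) hw ha0 ha1 haw haw'
  have key : ∀ z : K, z ^ 2 + z = (1 + a * c) * t ^ 2 / c → ∃ x,
      x = c * a * (a + 1) * z / (1 + a * c) ∧
      x ≠ 0 ∧ cDeriv c (invCycle w) a x = a⁻¹ + c := by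
    intro z hz
    obtain ⟨x, hx⟩ : ∃ x, x = c * a * (a + 1) * z / (1 + a * c) := ⟨_, rfl⟩
    refine ⟨x, hx, ?_⟩
    have hq : (1 + a * c) * x ^ 2 + c * a * (a + 1) * x + c * a ^ 2 = 0 := by
      have : (c * a * (a + 1)) ^ 2 * (z ^ 2 + z) = c * a ^ 2 * (1 + a * c) := by
        rw [hz]; field_simp; clear * - hta; grind
      rw [hx]
      field_simp
      clear * - this hc0 ha0
      grind
    clear hx hz
    have x0 : x ≠ 0 := by rintro rfl; clear * - hq ha0 hc0; grind
    have x1 : x ≠ 1 := by rintro rfl; clear * - hq ha0 hc0; grind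
    have xw : x ≠ w := by
      rintro rfl
      refine h (x ^ 2 * a) ?_
      field_simp
      clear * - hq hw; grind
    have y0 : x + a ≠ 0 := by clear * - hq ha0; grind
    have y1 : x + a ≠ 1 := by
      intro hxa
      have hx : x = a + 1 := by clear * - hxa; grind
      have : (d * a + a + 1) ^ 2 = 0 := by
        rw [hx, ← hd] at hq
        clear * - hq
        grind
      have := pow_eq_zero_iff (two_ne_zero) |>.1 this
      clear * - this t2 hta ha1
      grind
    have yw : x + a ≠ w := by
      intro hxa
      have hx : x = a + w := by clear * - hxa; grind
      rw [hx] at hq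
      have : w ^ 2 + a * c + a ^ 2 * (c * w + 1) = 0 := by
        clear * - hq hw
        grind
      have : t ^ 2 * (w ^ 2 + a * c + a ^ 2 * (c * w + 1)) = 0 := by rw [this, mul_zero]
      clear * - this t3 hta hw
      grind
    refine ⟨x0, ?_⟩
    rw [cDeriv, invCycle_of_ne x0 x1 xw, invCycle_of_ne y0 y1 yw]
    field_simp
    clear * - hq 
    grind
  -- Since at = t + 1, the right side is t² + t + t²/c, and t²/c = (y² + y)² by the choice of t.
  have hz : (t + y ^ 2) ^ 2 + (t + y ^ 2) = (1 + a * c) * t ^ 2 / c := by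
    field_simp
    have e1 : t ^ 2 = c * (y ^ 2 + y) ^ 2 := by rw [ht, ← hd]; ring
    have e2 : a * t = t + 1 := by clear * - hta; grind
    clear * - e1 e2
    grind
  obtain ⟨x, hx, x1, ex⟩ := key (t + y ^ 2) hz
  obtain ⟨x', hx', x1', ex'⟩ := key (t + y ^ 2 + 1) (by rw [← hz]; clear * -; grind)
  refine three_le_cUniformity hc1 e0 ex ex' x1.symm x1'.symm ?_
  rw [hx, hx']
  intro e
  field_simp at e
  clear * - e hb
  grind

end Lower

/-! ### Trace obstruction to y² + y = v -/

section Trace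

variable {K : Type*} [Field K] [Fintype K] [Algebra (ZMod 2) K]

theorem trace_sq_add_self (y : K) : Algebra.trace (ZMod 2) K (y ^ 2 + y) = 0 := by
  have : CharP K 2 := charP_of_injective_algebraMap (algebraMap (ZMod 2) K).injective 2
  have h := Algebra.trace_eq_of_algEquiv
    (FiniteField.frobeniusAlgEquivOfAlgebraic (ZMod 2) K) y
  simp only [FiniteField.coe_frobeniusAlgEquivOfAlgebraic, ZMod.card] at h
  rw [map_add, h, CharTwo.add_self_eq_zero]

theorem sq_add_self_ne_of_trace {v : K} (hv : Algebra.trace (ZMod 2) K v = 1) (y : K) :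
    y ^ 2 + y ≠ v := by
  rintro rfl
  simp [trace_sq_add_self] at hv

end Trace

theorem subfield_pow_four {K : Type*} [Field K] [Fintype K] {F₄ : Subfield K}
    (hF₄ : Nat.card F₄ = 4) {x : K} (hx : x ∈ F₄) : x ^ 4 = x := by
  have := Fintype.ofFinite F₄
  have h := FiniteField.pow_card (⟨x, hx⟩ : F₄)
  rw [← Nat.card_eq_fintype_card, hF₄] at h
  exact congrArg Subtype.val h

end CDiff

theorem mainTheorem8 {K : Type*} [Field K] [Fintype K] [DecidableEq K] [Algebra (ZMod 2) K]
    (n : ℕ) (hn : Even n) (hK : Fintype.card K = 2 ^ n)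
    (F₄ : Subfield K) (hF₄ : Nat.card F₄ = 4)
    (γ : K) (hγ : γ ∈ F₄) (hγ₂ : γ ∉ (algebraMap (ZMod 2) K).fieldRange)
    (c : K) (hc : c ∉ F₄) :
    (3 ≤ CDiff.cUniformity c (CDiff.invCycle γ) ∧ CDiff.cUniformity c (CDiff.invCycle γ) ≤ 4) ∧
    (Algebra.trace (ZMod 2) K (c * γ) = 1 →
      Algebra.trace (ZMod 2) K (c * γ ^ 2) = 1 →
      Algebra.trace (ZMod 2) K (c⁻¹ * γ) = 1 →
      Algebra.trace (ZMod 2) K (c⁻¹ * γ ^ 2) = 1 →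
      Algebra.trace (ZMod 2) K (c / (c + γ) ^ 2) = 1 →
      Algebra.trace (ZMod 2) K (c * γ ^ 2 / (c + γ) ^ 2) = 1 →
      Algebra.trace (ZMod 2) K (c * γ / (c + γ ^ 2) ^ 2) = 1 →
      Algebra.trace (ZMod 2) K (c / (c + γ ^ 2) ^ 2) = 1 →
      CDiff.cUniformity c (CDiff.invCycle γ) = 3) := by
  have hchar : CharP K 2 := charP_of_injective_algebraMap (algebraMap (ZMod 2) K).injective 2
  have h0 : γ ≠ 0 := by rintro rfl; exact hγ₂ (zero_mem _)
  have h1 : γ ≠ 1 := by rintro rfl; exact hγ₂ (one_mem _)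
  have hw : γ ^ 2 + γ + 1 = 0 := by
    have h4 := CDiff.subfield_pow_four hF₄ hγ
    have : γ * (γ + 1) * (γ ^ 2 + γ + 1) = 0 := by clear * - h4 hchar; grind
    refine (mul_eq_zero.1 this).resolve_left (mul_ne_zero h0 ?_)
    clear * - h1 hchar; grind
  have hc4 : c ^ 4 ≠ c := by
    intro h
    have : c * (c + 1) * (c + γ) * (c + (γ + 1)) = 0 := by clear * - h hw hchar; grind
    simp only [mul_eq_zero, CharTwo.add_eq_zero] at this
    rcases this with ((rfl | rfl) | rfl) | rfl
    · exact hc (zero_mem _)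
    · exact hc (one_mem _)
    · exact hc hγ
    · exact hc (add_mem hγ (one_mem _))
  have hcard : 16 ≤ Fintype.card K := by
    have h5 : 4 < Fintype.card K := by
      rw [← hF₄, ← Nat.card_eq_fintype_card, ← SetLike.coe_sort_coe, Nat.card_coe_set_eq,
        ← Set.ncard_univ]
      exact Set.ncard_lt_ncard (Set.ssubset_univ_iff.2 fun h => hc (h ▸ Set.mem_univ c :))
    rw [hK] at h5 ⊢
    -- Evenness lifts n > 2 to n ≥ 4, giving the 16 elements needed for the degree count.
    have h2 : 2 < n := (Nat.pow_lt_pow_iff_right (a := 2) one_lt_two).1 h5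
    obtain ⟨k, rfl⟩ := hn
    exact (show 16 = 2 ^ 4 from rfl) ▸ Nat.pow_le_pow_right two_pos (by omega)
  have hlow : 3 ≤ CDiff.cUniformity c (CDiff.invCycle γ) := by
    by_cases h : ∃ y : K, y ^ 2 + y = c⁻¹ * γ
    · exact CDiff.three_le_cUniformity_of_exists hw hc4 h
    · exact CDiff.three_le_cUniformity_of_forall hw hc4 hcard (not_exists.1 h)
  refine ⟨⟨hlow, CDiff.cUniformity_invCycle_le_four hw hc4⟩, ?_⟩
  intro t1 t2 t3 t4 t5 _ t6 _
  exact le_antisymm (CDiff.cUniformity_invCycle_le_three hw hc4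
    (CDiff.sq_add_self_ne_of_trace t1) (CDiff.sq_add_self_ne_of_trace t2)
    (CDiff.sq_add_self_ne_of_trace t3) (CDiff.sq_add_self_ne_of_trace t4)
    (CDiff.sq_add_self_ne_of_trace t5) (CDiff.sq_add_self_ne_of_trace t6)) hlow
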